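/- Let $n>2k\ge 6$ be integers, and write $[i]=\{1,\dots,i\}$ and $[2,i]=\{2,\dots,i\}$. For finite sets $A,B$ of positive integers put $A\le B$ if $A\supseteq B$ or $\min(A\setminus B)<\min(B\setminus A)$, and put $A<B$ if $A\le B$ and $A\ne B$. For a set $S$ and an integer $a$ let $$\mathcal L(S,a)=\Big\{A\in\tbinom{[2,n]}{a} : A\le S\cap[2,n]\Big\}.$$ Sets $S\subset[n]$ and $T\subset[2,n]$ *strongly intersect in their largest element* if there is $j$ with $S\cap T=\{j\}$ and $S\cup T=[j]$. Sets $S\subset [n]$, $T\subset[2,n]$ form a *resistant pair* if either $T=\{2,3,4\}$ and $S=\{1,4\}$, or, with $j$ the largest element of $T$, one has $S\cap T=\{j\}$, $S\cup T=[j]$, $|S|\le k$, $|T|\le k$, and $|[i]\cap S|<|[i]\setminus S|$ for every $i\ge 4$. Let $(S_1,T_1),\dots,(S_m,T_m)$ be all the resistant pairs, put $T_0=[2,n]$ and $S_0=\{1,n\}$, and let the numbering be such that $T_0<T_1<\dots<T_m$. A set is called *$T_l$-neutral* if it is obtained from $T_l$ by finitely many (possibly zero) steps, each replacing a set $T'$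 by $T'\cup\{2|T'|\}$; a pair $S,T$ strongly intersecting in its largest element is *$T_l$-neutral* if $T$ is $T_l$-neutral. **Theorem.** Let $S\subset[n]$ and $T\subset[2,n]$, with $|S|\le k$ and $|T|\le k$, strongly intersect in their largest element, and let $\mathcal A=\mathcal L(S,k-1)$ and $\mathcal B=\mathcal L(T,k)$. If $T_{l-1}<T\le T_l$ for some $l\in[m]$, then the equality $$|\mathcal A|+|\mathcal B|=|\mathcal L(S_l,k-1)|+|\mathcal L(T_l,k)|$$ holds if and only if the pair $S,T$ is $T_l$-neutral. -/

import Mathlib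

/-- The lexicographical/containment order on sets of positive integers: `A ≺ B` iff `A ⊇ B`, or the
minimal element of `A \ B` is smaller than the minimal element of `B \ A`. -/
def lexLE (A B : Finset ℕ) : Prop :=
  B ⊆ A ∨ ∃ x ∈ A \ B, ∀ y ∈ B \ A, x < y

instance : DecidableRel lexLE := fun A B => by
  unfold lexLE
  infer_instance

/-- The strict version of the order. -/
def lexLT (A B : Finset ℕ) : Prop :=
  lexLE A B ∧ A ≠ B

/-- The lexicographic family `𝓛([2, n], S, a)` of all `a`-element subsets of `[2, n]` that precede
`S ∩ [2, n]` (this is used for `|S ∩ [2, n]| ≤ a`, and for `S = [2, n]`, which gives the empty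
family). -/
def lexFamily (n : ℕ) (S : Finset ℕ) (a : ℕ) : Finset (Finset ℕ) :=
  (Finset.powersetCard a (Finset.Icc 2 n)).filter (fun A => lexLE A (S ∩ Finset.Icc 2 n))

/-- `S ⊆ [n]` (with `1 ∈ S`) and `T ⊆ [2, n]` strongly intersect in their largest element `j`:
`S ∩ T = {j}` and `S ∪ T = [j]`. -/
def StronglyIntersectInLargest (S T : Finset ℕ) : Prop :=
  ∃ j : ℕ, S ∩ T = {j} ∧ S ∪ T = Finset.Icc 1 j

/-- `S ⊆ [n]` and `T ⊆ [2, n]` form a resistant pair (with respect to `k`). -/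
def IsResistantPair (n k : ℕ) (S T : Finset ℕ) : Prop :=
  S ⊆ Finset.Icc 1 n ∧ T ⊆ Finset.Icc 2 n ∧
    ((T = {2, 3, 4} ∧ S = {1, 4}) ∨
      ∃ j : ℕ, IsGreatest (T : Set ℕ) j ∧
        (S ∩ T = {j} ∧ S ∪ T = Finset.Icc 1 j ∧ S.card ≤ k ∧ T.card ≤ k) ∧
        ∀ i : ℕ, 4 ≤ i → (Finset.Icc 1 i ∩ S).card < (Finset.Icc 1 i \ S).card)

/-- `(S 1, T 1), …, (S m, T m)` are all the resistant pairs, `T 0 = [2, n]`, `S 0 = {1, n}`, and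
`T 0 < T 1 < ⋯ < T m`. (The values of `S` and `T` at indices above `m` play no role.) -/
structure IsResistantEnumeration (n k m : ℕ) (S T : ℕ → Finset ℕ) : Prop where
  T_zero : T 0 = Finset.Icc 2 n
  S_zero : S 0 = {1, n}
  mem_iff : ∀ P Q : Finset ℕ,
    IsResistantPair n k P Q ↔ ∃ l ∈ Finset.Icc 1 m, S l = P ∧ T l = Q
  strictMono : ∀ i j : ℕ, i < j → j ≤ m → lexLT (T i) (T j)

/-- The sets `T` obtained from `R` by repeatedly passing from `T'` to `T' ∪ {2|T'|}`. -/
inductive IsNeutralSet (R : Finset ℕ) : Finset ℕ → Prop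
  | base : IsNeutralSet R R
  | step (T' : Finset ℕ) : IsNeutralSet R T' → IsNeutralSet R (T' ∪ {2 * T'.card})

/-- The pair `(S, T)` of sets, strongly intersecting in their largest element, is `R`-neutral. -/
def IsNeutralPair (R S T : Finset ℕ) : Prop :=
  StronglyIntersectInLargest S T ∧ IsNeutralSet R T

/-! Both families are counted by one recursion along `[2, n]`, so the total size depends only on how
the choices at successive integers split. As `S` is determined by `T`, everything is phrased through
`T` alone; resistance becomes a ballot condition (more than half of `[i]` lies in `T`) plus a
condition on the last element.

Neutral steps preserve the total (`pairCount_insert`): adjoining `2|T|` removes from the second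
family the sets that contain `T` and avoid everything else up to `2|T|`, and adds equally many sets
to the first. This gives one direction.

Conversely, if `T` satisfies the ballot condition, removing largest elements undoes neutral steps
until a resistant `R ⊆ T` is reached. No resistant set separates `R` from a set neutral over it
(`IsNeutralSet.lexLE_of_lexLE`), so `R = T_l` and `T` is `T_l`-neutral. If the ballot condition
fails, it first fails at some `i ∉ T` with `i = 2|U|`, `U = T ∩ [2, i]`. The same argument makes `U
∪ {i}` neutral over `T_l`, hence with the total of `T_l`, while `pairCount_lt` shows that the total
of `T` is strictly smaller, so equality fails. -/

/-! ### The order as comparison at the first difference -/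

/-- The containment clause and the minimum clause merge: in both, the first element where the sets
differ belongs to `A`. -/
theorem lexLE_iff {A B : Finset ℕ} :
    lexLE A B ↔ A = B ∨ ∃ x ∈ A, x ∉ B ∧ ∀ y < x, (y ∈ A ↔ y ∈ B) := by
  constructor
  · intro h
    by_cases hAB : A = B
    · exact Or.inl hAB
    right
    have hne : (A \ B).Nonempty := by
      rcases h with h | ⟨x, hx, -⟩
      · rw [Finset.sdiff_nonempty]
        exact fun h' => hAB (h'.antisymm h)
      · exact ⟨x, hx⟩
    have hmin := Finset.min'_mem _ hne
    rw [Finset.mem_sdiff] at hmin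
    refine ⟨(A \ B).min' hne, hmin.1, hmin.2, fun y hy => ⟨fun hyA => ?_, fun hyB => ?_⟩⟩
    · by_contra hyB
      exact absurd ((A \ B).min'_le y (Finset.mem_sdiff.2 ⟨hyA, hyB⟩)) (not_le.2 hy)
    · by_contra hyA
      rcases h with h | ⟨x, hx, h⟩
      · exact hyA (h hyB)
      · have h1 := h y (Finset.mem_sdiff.2 ⟨hyB, hyA⟩)
        have h2 := (A \ B).min'_le x hx
        omega
  · rintro (rfl | ⟨x, hxA, hxB, h⟩)
    · exact Or.inl subset_rfl
    · refine Or.inr ⟨x, Finset.mem_sdiff.2 ⟨hxA, hxB⟩, fun y hy => ?_⟩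
      rw [Finset.mem_sdiff] at hy
      by_contra hyx
      rcases (not_lt.1 hyx).lt_or_eq with h' | rfl
      · exact hy.2 ((h y h').2 hy.1)
      · exact hy.2 hxA

theorem lexLE_of_subset {A B : Finset ℕ} (h : B ⊆ A) : lexLE A B := Or.inl h

theorem lexLE_trans {A B C : Finset ℕ} (hAB : lexLE A B) (hBC : lexLE B C) : lexLE A C := by
  rw [lexLE_iff] at *
  rcases hAB with rfl | ⟨x, hx, hx', h⟩
  · exact hBC
  rcases hBC with rfl | ⟨y, hy, hy', h'⟩
  · exact Or.inr ⟨x, hx, hx', h⟩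
  right
  rcases lt_trichotomy x y with hxy | rfl | hxy
  · exact ⟨x, hx, fun hc => hx' ((h' x hxy).2 hc),
      fun z hz => (h z hz).trans (h' z (hz.trans hxy))⟩
  · exact absurd hy hx'
  · exact ⟨y, (h y hxy).2 hy, hy', fun z hz => (h z (hz.trans hxy)).trans (h' z hz)⟩

theorem lexLE_antisymm {A B : Finset ℕ} (hAB : lexLE A B) (hBA : lexLE B A) : A = B := by
  rw [lexLE_iff] at *
  rcases hAB with rfl | ⟨x, hx, hx', h⟩
  · rfl
  rcases hBA with rfl | ⟨y, hy, hy', h'⟩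
  · rfl
  exfalso
  rcases lt_trichotomy x y with hxy | rfl | hxy
  · exact hx' ((h' x hxy).2 hx)
  · exact hx' hy
  · exact hy' ((h y hxy).2 hy)

/-! ### Recursive counting of lexicographic families -/

/-- The number of `a`-element subsets of `(m, n]` that precede `S ∩ (m, n]`. -/
def lexCount (n : ℕ) (S : Finset ℕ) (m a : ℕ) : ℕ :=
  ((Finset.powersetCard a (Finset.Ioc m n)).filter
    (fun A => lexLE A (S ∩ Finset.Ioc m n))).card

theorem Ioc_eq_insert_succ {m n : ℕ} (h : m < n) :
    Finset.Ioc m n = insert (m + 1) (Finset.Ioc (m + 1) n) := by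
  ext x
  simp only [Finset.mem_Ioc, Finset.mem_insert]
  omega

theorem lexLE_insert_insert {x : ℕ} {A B : Finset ℕ} (hA : x ∉ A) (hB : x ∉ B) :
    lexLE (insert x A) (insert x B) ↔ lexLE A B := by
  have h : ∀ A B : Finset ℕ, x ∉ A → insert x A \ insert x B = A \ B := by
    intro A B hA
    ext y
    simp only [Finset.mem_sdiff, Finset.mem_insert]
    by_cases h : y = x
    · subst h; simp [hA]
    · simp [h]
  unfold lexLE
  rw [h A B hA, h B A hB, Finset.insert_subset_insert_iff hB]

theorem not_lexLE_insert {x : ℕ} {A B : Finset ℕ} (hA : ∀ y ∈ A, x < y) :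
    ¬ lexLE A (insert x B) := by
  have hx : x ∉ A := fun h => lt_irrefl _ (hA x h)
  rintro (h | ⟨y, hy, h⟩)
  · exact hx (h (Finset.mem_insert_self _ _))
  · have h1 := h x (Finset.mem_sdiff.2 ⟨Finset.mem_insert_self _ _, hx⟩)
    have h2 := hA y (Finset.mem_sdiff.1 hy).1
    omega

theorem insert_lexLE {x : ℕ} {A B : Finset ℕ} (hB : ∀ y ∈ B, x < y) : lexLE (insert x A) B :=
  Or.inr ⟨x, Finset.mem_sdiff.2 ⟨Finset.mem_insert_self _ _, fun h => lt_irrefl _ (hB x h)⟩,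
    fun y hy => hB y (Finset.mem_sdiff.1 hy).1⟩

theorem card_filter_powersetCard_insert {x : ℕ} {s : Finset ℕ} (hx : x ∉ s) (a : ℕ)
    (P : Finset ℕ → Prop) [DecidablePred P] :
    ((Finset.powersetCard (a + 1) (insert x s)).filter P).card =
      ((Finset.powersetCard (a + 1) s).filter P).card +
        ((Finset.powersetCard a s).filter (fun A => P (insert x A))).card := by
  rw [Finset.powersetCard_succ_insert hx, Finset.filter_union, Finset.card_union_of_disjoint]
  · congr 1
    rw [Finset.filter_image, Finset.card_image_of_injOn]
    intro A hA B hB hAB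
    have hA' : x ∉ A := fun h =>
      hx ((Finset.mem_powersetCard.1 (Finset.mem_filter.1 hA).1).1 h)
    have hB' : x ∉ B := fun h =>
      hx ((Finset.mem_powersetCard.1 (Finset.mem_filter.1 hB).1).1 h)
    rw [← Finset.erase_insert hA', ← Finset.erase_insert hB']
    exact congrArg (fun C : Finset ℕ => C.erase x) hAB
  · rw [Finset.disjoint_left]
    intro A hA hA'
    obtain ⟨B, -, rfl⟩ := Finset.mem_image.1 (Finset.mem_filter.1 hA').1
    exact hx ((Finset.mem_powersetCard.1 (Finset.mem_filter.1 hA).1).1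
      (Finset.mem_insert_self _ _))

theorem lexCount_succ_of_mem {n m a : ℕ} {S : Finset ℕ} (h : m < n) (hS : m + 1 ∈ S) :
    lexCount n S m (a + 1) = lexCount n S (m + 1) a := by
  have hx : m + 1 ∉ Finset.Ioc (m + 1) n := by simp
  unfold lexCount
  rw [Ioc_eq_insert_succ h, Finset.inter_insert_of_mem hS, card_filter_powersetCard_insert hx,
    Finset.filter_false_of_mem, Finset.card_empty, zero_add]
  · congr 1
    apply Finset.filter_congr
    intro A hA
    exact lexLE_insert_insert (fun h' => hx ((Finset.mem_powersetCard.1 hA).1 h'))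
      (fun h' => hx (Finset.mem_inter.1 h').2)
  · intro A hA
    exact not_lexLE_insert fun y hy =>
      (Finset.mem_Ioc.1 ((Finset.mem_powersetCard.1 hA).1 hy)).1

theorem lexCount_succ_of_notMem {n m a : ℕ} {S : Finset ℕ} (h : m < n) (hS : m + 1 ∉ S) :
    lexCount n S m (a + 1) = (n - (m + 1)).choose a + lexCount n S (m + 1) (a + 1) := by
  have hx : m + 1 ∉ Finset.Ioc (m + 1) n := by simp
  unfold lexCount
  rw [Ioc_eq_insert_succ h, Finset.inter_insert_of_notMem hS,
    card_filter_powersetCard_insert hx, add_comm]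
  congr 1
  rw [Finset.filter_true_of_mem, Finset.card_powersetCard, Nat.card_Ioc]
  intro A _
  exact insert_lexLE fun y hy => (Finset.mem_Ioc.1 (Finset.mem_inter.1 hy).2).1

theorem lexCount_zero_of_notMem {n m : ℕ} {S : Finset ℕ} (h : m < n) (hS : m + 1 ∉ S) :
    lexCount n S m 0 = lexCount n S (m + 1) 0 := by
  unfold lexCount
  rw [Ioc_eq_insert_succ h, Finset.inter_insert_of_notMem hS, Finset.powersetCard_zero,
    Finset.powersetCard_zero]

theorem lexCount_of_forall_notMem {n m a : ℕ} {S : Finset ℕ} (hS : ∀ x ∈ S, x ≤ m) :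
    lexCount n S m a = (n - m).choose a := by
  have h : S ∩ Finset.Ioc m n = ∅ := by
    ext x
    simp only [Finset.mem_inter, Finset.mem_Ioc, Finset.notMem_empty, iff_false]
    intro h
    have := hS x h.1
    omega
  unfold lexCount
  rw [h, Finset.filter_true_of_mem (fun A _ => lexLE_of_subset (Finset.empty_subset A)),
    Finset.card_powersetCard, Nat.card_Ioc]

/-- The number of elements of `T` in `(m, i]`. -/
def prefixCard (T : Finset ℕ) (m i : ℕ) : ℕ := (T ∩ Finset.Ioc m i).card

theorem prefixCard_self (T : Finset ℕ) (m : ℕ) : prefixCard T m m = 0 := by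
  simp [prefixCard]

theorem prefixCard_succ_of_mem {T : Finset ℕ} {m i : ℕ} (h : m ≤ i) (hT : i + 1 ∈ T) :
    prefixCard T m (i + 1) = prefixCard T m i + 1 := by
  have : Finset.Ioc m (i + 1) = insert (i + 1) (Finset.Ioc m i) := by
    ext x; simp only [Finset.mem_Ioc, Finset.mem_insert]; omega
  unfold prefixCard
  rw [this, Finset.inter_insert_of_mem hT, Finset.card_insert_of_notMem]
  simp

theorem prefixCard_succ_of_notMem {T : Finset ℕ} {m i : ℕ} (h : m ≤ i) (hT : i + 1 ∉ T) :
    prefixCard T m (i + 1) = prefixCard T m i := by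
  have : Finset.Ioc m (i + 1) = insert (i + 1) (Finset.Ioc m i) := by
    ext x; simp only [Finset.mem_Ioc, Finset.mem_insert]; omega
  unfold prefixCard
  rw [this, Finset.inter_insert_of_notMem hT]

theorem prefixCard_left_of_mem {T : Finset ℕ} {m i : ℕ} (h : m < i) (hT : m + 1 ∈ T) :
    prefixCard T m i = prefixCard T (m + 1) i + 1 := by
  unfold prefixCard
  rw [Ioc_eq_insert_succ h, Finset.inter_insert_of_mem hT, Finset.card_insert_of_notMem]
  simp

theorem prefixCard_left_of_notMem {T : Finset ℕ} {m i : ℕ} (h : m < i) (hT : m + 1 ∉ T) :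
    prefixCard T m i = prefixCard T (m + 1) i := by
  unfold prefixCard
  rw [Ioc_eq_insert_succ h, Finset.inter_insert_of_notMem hT]

theorem prefixCard_congr {T T' : Finset ℕ} {m i : ℕ} (h : ∀ x, m < x → x ≤ i → (x ∈ T ↔ x ∈ T')) :
    prefixCard T m i = prefixCard T' m i := by
  unfold prefixCard
  congr 1
  ext x
  simp only [Finset.mem_inter, Finset.mem_Ioc]
  constructor
  · rintro ⟨h1, h2, h3⟩; exact ⟨(h x h2 h3).1 h1, h2, h3⟩
  · rintro ⟨h1, h2, h3⟩; exact ⟨(h x h2 h3).2 h1, h2, h3⟩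

theorem prefixCard_eq_card {T : Finset ℕ} {m i : ℕ} (h : ∀ x ∈ T, m < x ∧ x ≤ i) :
    prefixCard T m i = T.card := by
  unfold prefixCard
  rw [Finset.inter_eq_left.2 fun x hx => Finset.mem_Ioc.2 (h x hx)]

theorem prefixCard_add_prefixCard {S T : Finset ℕ} {m i : ℕ}
    (h : ∀ x, m < x → x ≤ i → (x ∈ S ↔ x ∉ T)) :
    prefixCard S m i + prefixCard T m i = i - m := by
  unfold prefixCard
  rw [← Finset.card_union_of_disjoint, ← Finset.union_inter_distrib_right,
    Finset.inter_eq_right.2, Nat.card_Ioc]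
  · intro x hx
    rw [Finset.mem_Ioc] at hx
    rw [Finset.mem_union, h x hx.1 hx.2]
    tauto
  · rw [Finset.disjoint_left]
    intro x hx hx'
    rw [Finset.mem_inter, Finset.mem_Ioc] at hx hx'
    exact (h x hx.2.1 hx.2.2).1 hx.1 hx'.1

/-- Along a common prefix both recursions pick up the same binomial terms, so only the tails beyond
`i` differ. The additive form avoids truncated subtraction. -/
theorem lexCount_compare {n i : ℕ} {T T' : Finset ℕ} (d : ℕ) : ∀ {m a : ℕ}, m + d = i → i ≤ n →
    (∀ x, m < x → x ≤ i → (x ∈ T ↔ x ∈ T')) →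
    lexCount n T m (prefixCard T m i + a) + lexCount n T' i a =
      lexCount n T' m (prefixCard T m i + a) + lexCount n T i a := by
  induction d with
  | zero =>
    intro m a hm _ _
    obtain rfl : m = i := by omega
    rw [prefixCard_self, zero_add, add_comm]
  | succ d ih =>
    intro m a hm hi h
    have hmn : m < n := by omega
    have hmi : m < i := by omega
    have ih' := @ih (m + 1) a (by omega) hi (fun x h1 h2 => h x (by omega) h2)
    have hmem := h (m + 1) (by omega) (by omega)
    by_cases hT : m + 1 ∈ T
    · have hT' := hmem.1 hT
      rw [prefixCard_left_of_mem hmi hT, Nat.add_right_comm, lexCount_succ_of_mem hmn hT,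
        lexCount_succ_of_mem hmn hT', ih']
    · have hT' := fun h' => hT (hmem.2 h')
      rw [prefixCard_left_of_notMem hmi hT]
      -- With nothing left to choose, no counted set contains `m + 1`, so the Pascal-type recursion
      -- is unavailable and not needed.
      rcases (prefixCard T (m + 1) i + a).eq_zero_or_pos with h0 | h0
      · rw [h0] at ih' ⊢
        rw [lexCount_zero_of_notMem hmn hT, lexCount_zero_of_notMem hmn hT', ih']
      · obtain ⟨b, hb⟩ := Nat.exists_eq_add_of_lt h0
        rw [hb, zero_add] at ih' ⊢
        rw [lexCount_succ_of_notMem hmn hT, lexCount_succ_of_notMem hmn hT', add_assoc, ih',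
          add_assoc]

theorem lexCount_of_Ioc_subset {n i : ℕ} {S : Finset ℕ} (d : ℕ) : ∀ {m a : ℕ}, m + d = i →
    i ≤ n → (∀ x, m < x → x ≤ i → x ∈ S) → lexCount n S m (a + d) = lexCount n S i a := by
  induction d with
  | zero =>
    intro m a hm _ _
    obtain rfl : m = i := by omega
    rfl
  | succ d ih =>
    intro m a hm hi h
    rw [← add_assoc, lexCount_succ_of_mem (by omega) (h _ (by omega) (by omega)),
      ih (by omega) hi fun x h1 h2 => h x (by omega) h2]

/-- Beyond `m` the set `T` is just `{i}`; the sets that fail to precede it are those avoiding `(m,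
i]`. -/
theorem lexCount_of_singleton {n i a : ℕ} {T : Finset ℕ} (hi : i ≤ n) (hiT : i ∈ T)
    (hT : ∀ x ∈ T, x ≤ i) (d : ℕ) : ∀ {m : ℕ}, m + d + 1 = i →
    (∀ x, m < x → x < i → x ∉ T) →
    lexCount n T m (a + 1) + (n - i).choose (a + 1) = (n - m).choose (a + 1) := by
  induction d with
  | zero =>
    intro m hm _
    obtain rfl : m + 1 = i := by omega
    obtain ⟨N, hN⟩ : ∃ N, n = m + 1 + N := ⟨n - (m + 1), by omega⟩
    rw [lexCount_succ_of_mem (by omega) hiT, lexCount_of_forall_notMem hT,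
      show n - m = n - (m + 1) + 1 by omega, Nat.choose_succ_succ]
  | succ d ih =>
    intro m hm h
    rw [lexCount_succ_of_notMem (by omega) (h _ (by omega) (by omega)), add_assoc,
      ih (by omega) fun x h1 h2 => h x (by omega) h2, show n - m = n - (m + 1) + 1 by omega,
      Nat.choose_succ_succ]

/-! ### Binomial inequalities -/

theorem choose_lt_choose_of_two_mul_le {N p q : ℕ} (hpq : p < q) (h : 2 * q ≤ N) :
    N.choose p < N.choose q := by
  have step : ∀ r, 2 * r + 1 < N → N.choose r < N.choose (r + 1) := by
    intro r hr
    have h1 := Nat.choose_succ_right_eq N r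
    have h2 : 0 < N.choose r := Nat.choose_pos (by omega)
    by_contra hc
    have h3 : r + 1 < N - r := by omega
    have h4 : N.choose (r + 1) * (r + 1) ≤ N.choose r * (r + 1) :=
      Nat.mul_le_mul_right _ (not_lt.1 hc)
    have h5 : N.choose r * (r + 1) < N.choose r * (N - r) := Nat.mul_lt_mul_of_pos_left h3 h2
    omega
  induction q, hpq using Nat.le_induction with
  | base => exact step p (by omega)
  | succ q hq ih => exact (ih (by omega)).trans (step q (by omega))

theorem choose_lt_choose_of_add_lt {N p q : ℕ} (hpq : p < q) (h : p + q < N) :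
    N.choose p < N.choose q := by
  rcases le_or_gt (2 * q) N with hq | hq
  · exact choose_lt_choose_of_two_mul_le hpq hq
  -- Past the middle, `q` is reflected to `N - q`, which still exceeds `p`.
  · rw [← Nat.choose_symm (show q ≤ N by omega)]
    exact choose_lt_choose_of_two_mul_le (by omega) (by omega)

theorem choose_add_choose_lt_max {N a b : ℕ} (h : a + b + 1 < N) :
    N.choose a + N.choose b < max ((N + 1).choose (a + 1)) ((N + 1).choose (b + 1)) := by
  rw [lt_max_iff, Nat.choose_succ_succ, Nat.choose_succ_succ]
  rcases le_total a b with hab | hab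
  · right
    have := @choose_lt_choose_of_add_lt N a (b + 1) (by omega) (by omega)
    simp only [Nat.succ_eq_add_one]
    omega
  · left
    have := @choose_lt_choose_of_add_lt N b (a + 1) (by omega) (by omega)
    simp only [Nat.succ_eq_add_one]
    omega

theorem choose_add_lt_max {N a b c : ℕ} (h : a + b + 1 < N)
    (hc : c < max (N.choose a) (N.choose (b + 1))) :
    N.choose b + c < max ((N + 1).choose (a + 1)) ((N + 1).choose (b + 1)) := by
  rcases lt_max_iff.1 hc with hc | hc
  · have := choose_add_choose_lt_max h
    omega
  · refine lt_max_iff.2 (Or.inr ?_)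
    rw [Nat.choose_succ_succ]
    simp only [Nat.succ_eq_add_one]
    omega

/-! ### Mate pairs and their total count -/

/-- `S` and `T` meet only in `j` and together cover `[j]`, where `1` does not lie in `T`. -/
structure IsMatePair (S T : Finset ℕ) (j : ℕ) : Prop where
  mem_left : j ∈ S
  mem_right : j ∈ T
  left_le : ∀ x ∈ S, 1 ≤ x ∧ x ≤ j
  right_le : ∀ x ∈ T, 2 ≤ x ∧ x ≤ j
  iff : ∀ x, 1 ≤ x → x < j → (x ∈ S ↔ x ∉ T)

/-- Before `j`, each integer lies in exactly one of `S`, `T`: that side spends one unit of its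
budget, the other gains a full binomial, and `choose_add_lt_max` absorbs the gain. At `j` both sides
spend a unit, which makes the bound strict. -/
theorem lexCount_add_lexCount_lt {n j : ℕ} {S T : Finset ℕ} (h : IsMatePair S T j) (hj : j ≤ n)
    (d : ℕ) : ∀ {m a b : ℕ}, m + d + 1 = j → prefixCard T m j ≤ a → prefixCard S m j ≤ b →
    a + b < n - m →
    lexCount n T m a + lexCount n S m b < max ((n - m).choose a) ((n - m).choose b) := by
  induction d with
  | zero =>
    intro m a b hm ha hb hab
    obtain rfl : m + 1 = j := by omega
    rw [prefixCard_left_of_mem (by omega) h.mem_right] at ha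
    rw [prefixCard_left_of_mem (by omega) h.mem_left] at hb
    obtain ⟨a, rfl⟩ : ∃ a', a = a' + 1 := ⟨a - 1, by omega⟩
    obtain ⟨b, rfl⟩ : ∃ b', b = b' + 1 := ⟨b - 1, by omega⟩
    rw [lexCount_succ_of_mem (by omega) h.mem_right, lexCount_succ_of_mem (by omega) h.mem_left,
      lexCount_of_forall_notMem fun x hx => (h.left_le x hx).2,
      lexCount_of_forall_notMem fun x hx => (h.right_le x hx).2,
      show n - m = n - (m + 1) + 1 by omega]
    exact choose_add_choose_lt_max (by omega)
  | succ d ih =>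
    intro m a b hm ha hb hab
    have hmj : m < j := by omega
    have hmj' : m + 1 < j := by omega
    have hposT : 0 < prefixCard T (m + 1) j := Finset.card_pos.2
      ⟨j, Finset.mem_inter.2 ⟨h.mem_right, Finset.mem_Ioc.2 ⟨hmj', le_rfl⟩⟩⟩
    have hposS : 0 < prefixCard S (m + 1) j := Finset.card_pos.2
      ⟨j, Finset.mem_inter.2 ⟨h.mem_left, Finset.mem_Ioc.2 ⟨hmj', le_rfl⟩⟩⟩
    have hmem := h.iff (m + 1) (by omega) hmj'
    have hn : n - m = n - (m + 1) + 1 := by omega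
    by_cases hT : m + 1 ∈ T
    · have hS : m + 1 ∉ S := fun h' => hmem.1 h' hT
      rw [prefixCard_left_of_mem hmj hT] at ha
      rw [prefixCard_left_of_notMem hmj hS] at hb
      obtain ⟨a, rfl⟩ : ∃ a', a = a' + 1 := ⟨a - 1, by omega⟩
      obtain ⟨b, rfl⟩ : ∃ b', b = b' + 1 := ⟨b - 1, by omega⟩
      have := @ih (m + 1) a (b + 1) (by omega) (by omega) hb (by omega)
      rw [lexCount_succ_of_mem (by omega) hT, lexCount_succ_of_notMem (by omega) hS, hn,
        add_left_comm]
      exact choose_add_lt_max (by omega) this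
    · have hS : m + 1 ∈ S := hmem.2 hT
      rw [prefixCard_left_of_notMem hmj hT] at ha
      rw [prefixCard_left_of_mem hmj hS] at hb
      obtain ⟨a, rfl⟩ : ∃ a', a = a' + 1 := ⟨a - 1, by omega⟩
      obtain ⟨b, rfl⟩ : ∃ b', b = b' + 1 := ⟨b - 1, by omega⟩
      have := @ih (m + 1) (a + 1) b (by omega) ha (by omega) (by omega)
      rw [lexCount_succ_of_mem (by omega) hS, lexCount_succ_of_notMem (by omega) hT, hn,
        add_assoc, max_comm]
      rw [max_comm] at this
      exact choose_add_lt_max (by omega) this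

/-- The total size of the two lexicographic families given by `S` and `T`. -/
def pairCount (n k : ℕ) (S T : Finset ℕ) : ℕ := lexCount n S 1 (k - 1) + lexCount n T 1 k

theorem IsMatePair.unique {S S' T : Finset ℕ} {j j' : ℕ} (h : IsMatePair S T j)
    (h' : IsMatePair S' T j') : S = S' ∧ j = j' := by
  obtain rfl : j = j' :=
    le_antisymm (h'.right_le j h.mem_right).2 (h.right_le j' h'.mem_right).2
  refine ⟨?_, rfl⟩
  ext x
  by_cases hx : 1 ≤ x ∧ x ≤ j
  · rcases hx.2.lt_or_eq with hj | rfl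
    · rw [h.iff x hx.1 hj, h'.iff x hx.1 hj]
    · exact iff_of_true h.mem_left h'.mem_left
  · exact iff_of_false (fun h1 => hx (h.left_le x h1)) (fun h1 => hx (h'.left_le x h1))

theorem exists_isMatePair {T : Finset ℕ} {j : ℕ} (hj : j ∈ T) (hT : ∀ x ∈ T, 2 ≤ x ∧ x ≤ j) :
    ∃ S, IsMatePair S T j := by
  refine ⟨insert j (Finset.Icc 1 j \ T), Finset.mem_insert_self _ _, hj, ?_, hT, ?_⟩
  · intro x hx
    rw [Finset.mem_insert, Finset.mem_sdiff, Finset.mem_Icc] at hx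
    have := hT j hj
    omega
  · intro x hx hxj
    rw [Finset.mem_insert, Finset.mem_sdiff, Finset.mem_Icc]
    constructor
    · rintro (rfl | h)
      · omega
      · exact h.2
    · exact fun h => Or.inr ⟨⟨hx, hxj.le⟩, h⟩

theorem IsMatePair.union {S T : Finset ℕ} {j : ℕ} (h : IsMatePair S T j) :
    S ∪ T = Finset.Icc 1 j := by
  ext x
  rw [Finset.mem_union, Finset.mem_Icc]
  constructor
  · rintro (hx | hx)
    · exact h.left_le x hx
    · have := h.right_le x hx
      omega
  · rintro ⟨h1, h2⟩
    rcases h2.lt_or_eq with h2 | rfl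
    · rw [h.iff x h1 h2]
      tauto
    · exact Or.inl h.mem_left

theorem IsMatePair.inter {S T : Finset ℕ} {j : ℕ} (h : IsMatePair S T j) : S ∩ T = {j} := by
  ext x
  rw [Finset.mem_inter, Finset.mem_singleton]
  constructor
  · rintro ⟨h1, h2⟩
    by_contra hne
    have h3 := h.left_le x h1
    exact (h.iff x h3.1 (by omega)).1 h1 h2
  · rintro rfl
    exact ⟨h.mem_left, h.mem_right⟩

theorem isMatePair_of_inter_of_union {n j : ℕ} {S T : Finset ℕ} (hT : T ⊆ Finset.Icc 2 n)
    (hi : S ∩ T = {j}) (hu : S ∪ T = Finset.Icc 1 j) : IsMatePair S T j := by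
  have hj : j ∈ S ∩ T := by rw [hi]; exact Finset.mem_singleton_self j
  rw [Finset.mem_inter] at hj
  have hle : ∀ x, (x ∈ S ∨ x ∈ T) ↔ 1 ≤ x ∧ x ≤ j := fun x => by
    rw [← Finset.mem_union, hu, Finset.mem_Icc]
  refine ⟨hj.1, hj.2, fun x hx => (hle x).1 (Or.inl hx), fun x hx =>
    ⟨(Finset.mem_Icc.1 (hT hx)).1, ((hle x).1 (Or.inr hx)).2⟩, fun x h1 h2 => ⟨fun hS hT' => ?_,
    fun hT' => ((hle x).2 ⟨h1, h2.le⟩).resolve_right hT'⟩⟩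
  have : x ∈ S ∩ T := Finset.mem_inter.2 ⟨hS, hT'⟩
  rw [hi, Finset.mem_singleton] at this
  omega

theorem IsMatePair.card_add_card {S T : Finset ℕ} {j : ℕ} (h : IsMatePair S T j) :
    S.card + T.card = j + 1 := by
  rw [← Finset.card_union_add_card_inter, h.union, h.inter, Nat.card_Icc, Finset.card_singleton]
  omega

theorem IsMatePair.prefixCard_card {S T : Finset ℕ} {i : ℕ} (h : IsMatePair S T (i + 1)) :
    prefixCard T 1 i + 1 = T.card := by
  have h2 := h.right_le _ h.mem_right
  rw [← prefixCard_succ_of_mem (by omega) h.mem_right, prefixCard_eq_card]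
  intro x hx
  have := h.right_le x hx
  omega

/-- The loss on one side and the gain on the other are both `(n - 2|T|).choose (k - |T|)`. The
choice of `2|T|` makes the lower indices agree: the new `S'` has `|T| - 1` elements above `1`,
leaving `k - 1 - (|T| - 1)` to choose. -/
theorem pairCount_insert {n k j : ℕ} {S T S' : Finset ℕ} (hn : 2 * k < n)
    (h : IsMatePair S T j) (h' : IsMatePair S' (insert (2 * T.card) T) (2 * T.card))
    (hj : j < 2 * T.card) (hk : T.card + 1 ≤ k) :
    pairCount n k S' (insert (2 * T.card) T) = pairCount n k S T := by
  have hj2 := (h.right_le j h.mem_right).1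
  obtain ⟨i, rfl⟩ : ∃ i, j = i + 1 := ⟨j - 1, by omega⟩
  have hiT := h.prefixCard_card
  have hST := prefixCard_add_prefixCard (S := S) (T := T) (m := 1) (i := i)
    fun x h1 h2 => h.iff x (by omega) (by omega)
  have hTT : ∀ x, x < 2 * T.card → (x ∈ insert (2 * T.card) T ↔ x ∈ T) := fun x hx => by
    rw [Finset.mem_insert]
    exact ⟨fun h => h.resolve_left hx.ne, Or.inr⟩
  have hSS : ∀ x, 1 < x → x ≤ i → (x ∈ S ↔ x ∈ S') := fun x h1 h2 => by
    rw [h.iff x (by omega) (by omega), h'.iff x (by omega) (by omega), hTT x (by omega)]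
  have hT'S' : ∀ x, i + 1 < x → x < 2 * T.card → x ∉ insert (2 * T.card) T := fun x h1 h2 hx => by
    have := h.right_le x ((hTT x h2).1 hx)
    omega
  obtain ⟨a, ha⟩ : ∃ a, k = T.card + (a + 1) := ⟨k - T.card - 1, by omega⟩
  have e1 := lexCount_compare (T := T) (T' := insert (2 * T.card) T) (n := n) (a := a + 2) (i := i)
    (i - 1) (m := 1) (by omega) (by omega) fun x h1 h2 => (hTT x (by omega)).symm
  have e2 := lexCount_compare (T := S) (T' := S') (n := n) (a := 2 * T.card - i + a) (i := i)
    (i - 1) (m := 1) (by omega) (by omega) hSS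
  rw [show prefixCard T 1 i + (a + 2) = k by omega,
    lexCount_succ_of_mem (by omega) h.mem_right,
    lexCount_succ_of_mem (by omega) ((hTT (i + 1) hj).2 h.mem_right),
    lexCount_of_forall_notMem (S := T) fun x hx => (h.right_le x hx).2] at e1
  rw [show prefixCard S 1 i + (2 * T.card - i + a) = k - 1 by omega,
    show 2 * T.card - i + a = 2 * T.card - (i + 1) + a + 1 by omega,
    lexCount_succ_of_mem (by omega) h.mem_left,
    lexCount_succ_of_notMem (by omega) fun hc =>
      (h'.iff (i + 1) (by omega) hj).1 hc ((hTT (i + 1) hj).2 h.mem_right),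
    lexCount_of_forall_notMem (S := S) fun x hx => (h.left_le x hx).2,
    show 2 * T.card - (i + 1) + a + 1 = a + 1 + (2 * T.card - (i + 1)) by omega,
    lexCount_of_Ioc_subset (i := 2 * T.card) (2 * T.card - (i + 1)) (by omega) (by omega)
      (fun x h1 h2 => by
        rcases h2.lt_or_eq with h2 | rfl
        · exact (h'.iff x (by omega) h2).2 (hT'S' x h1 h2)
        · exact h'.mem_left),
    lexCount_of_forall_notMem (S := S') fun x hx => (h'.left_le x hx).2] at e2
  have e3 := lexCount_of_singleton (n := n) (a := a) (i := 2 * T.card) (by omega) h'.mem_right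
    (fun x hx => (h'.right_le x hx).2) (2 * T.card - (i + 1) - 1) (m := i + 1) (by omega) hT'S'
  unfold pairCount
  omega

/-- The invariant `j' < 2|T|` ensures that every adjoined element is a new maximum, so a mate exists
at each stage. -/
theorem IsNeutralSet.isMatePair_pairCount {n k j : ℕ} {S R T : Finset ℕ} (hn : 2 * k < n)
    (h : IsMatePair S R j) (hj : j < 2 * R.card) (hT : IsNeutralSet R T) :
    ∃ S' j', IsMatePair S' T j' ∧ j' < 2 * T.card ∧ R ⊆ T ∧
      (T.card ≤ k → pairCount n k S' T = pairCount n k S R) := by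
  induction hT with
  | base => exact ⟨S, j, h, hj, subset_rfl, fun _ => rfl⟩
  | step T' _ ih =>
    obtain ⟨S₁, j₁, h₁, hj₁, hR, hc⟩ := ih
    rw [Finset.union_comm, ← Finset.insert_eq]
    have hnot : 2 * T'.card ∉ T' := fun hc => by
      have := (h₁.right_le _ hc).2
      omega
    obtain ⟨S₂, h₂⟩ := exists_isMatePair (T := insert (2 * T'.card) T')
      (Finset.mem_insert_self _ _) (fun x hx => by
        rw [Finset.mem_insert] at hx
        rcases hx with rfl | hx
        · have := h₁.right_le _ h₁.mem_right
          omega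
        · have := h₁.right_le x hx
          omega)
    refine ⟨S₂, _, h₂, ?_, hR.trans (Finset.subset_insert _ _), ?_⟩
    · rw [Finset.card_insert_of_notMem hnot]
      omega
    · rw [Finset.card_insert_of_notMem hnot]
      intro hk
      rw [pairCount_insert hn h₁ h₂ hj₁ hk, hc (by omega)]

/-! ### Ballot sets, resistant sets and neutral chains -/

/-- `T` has largest element `j`, contains `2, 3, 4`, and more than half of `[i]` lies in `T`
whenever `4 ≤ i < j`. -/
structure IsBallot (T : Finset ℕ) (j : ℕ) : Prop where
  base : {2, 3, 4} ⊆ T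
  mem : j ∈ T
  le : ∀ x ∈ T, 2 ≤ x ∧ x ≤ j
  height : ∀ i, 4 ≤ i → i < j → i < 2 * prefixCard T 1 i

/-- The condition on `T` that makes it the second member of a resistant pair. -/
structure IsResistantSet (T : Finset ℕ) (j : ℕ) : Prop extends IsBallot T j where
  last : T = {2, 3, 4} ∨ j + 2 < 2 * T.card

theorem IsBallot.four_le {T : Finset ℕ} {j : ℕ} (h : IsBallot T j) : 4 ≤ j :=
  (h.le 4 (h.base (by simp))).2

theorem IsBallot.eq_of_eq_four {T : Finset ℕ} (h : IsBallot T 4) : T = {2, 3, 4} := by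
  refine Finset.Subset.antisymm (fun x hx => ?_) h.base
  have := h.le x hx
  simp only [Finset.mem_insert, Finset.mem_singleton]
  omega

theorem IsBallot.lt_two_mul_card {T : Finset ℕ} {j : ℕ} (h : IsBallot T j) : j < 2 * T.card := by
  have h4 := h.four_le
  rcases h4.lt_or_eq with h4 | rfl
  · obtain ⟨S, hS⟩ := exists_isMatePair h.mem h.le
    obtain ⟨i, rfl⟩ : ∃ i, j = i + 1 := ⟨j - 1, by omega⟩
    have h1 := hS.prefixCard_card
    have h2 := h.height i (by omega) (by omega)
    omega
  · rw [h.eq_of_eq_four]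
    decide

theorem three_le_card_of_subset {T : Finset ℕ} (h : {2, 3, 4} ⊆ T) : 3 ≤ T.card := by
  have := Finset.card_le_card h
  rwa [show ({2, 3, 4} : Finset ℕ).card = 3 by decide] at this

/-- A ballot set that is not resistant has `j = 2(|T| - 1)`, so its largest element is exactly what
a neutral step adjoins to the rest; erase it and induct. -/
theorem IsBallot.exists_isResistantSet {T : Finset ℕ} {j : ℕ} (h : IsBallot T j) :
    ∃ R j', IsResistantSet R j' ∧ R ⊆ T ∧ IsNeutralSet R T := by
  induction j using Nat.strong_induction_on generalizing T with
  | _ j ih =>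
    by_cases hl : T = {2, 3, 4} ∨ j + 2 < 2 * T.card
    · exact ⟨T, j, ⟨h, hl⟩, subset_rfl, .base⟩
    rw [not_or] at hl
    have h4 : 4 < j := by
      rcases h.four_le.lt_or_eq with h4 | rfl
      · exact h4
      · exact absurd h.eq_of_eq_four hl.1
    have hbase : {2, 3, 4} ⊆ T.erase j := fun x hx => by
      rw [Finset.mem_erase]
      refine ⟨?_, h.base hx⟩
      simp only [Finset.mem_insert, Finset.mem_singleton] at hx
      omega
    have hne : (T.erase j).Nonempty := ⟨2, hbase (by simp)⟩
    have hmax := Finset.max'_mem _ hne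
    set q := (T.erase j).max' hne with hq
    have hqj : q < j := lt_of_le_of_ne (h.le q (Finset.mem_of_mem_erase hmax)).2
      (Finset.ne_of_mem_erase hmax)
    have hlt := h.lt_two_mul_card
    obtain ⟨S, hS⟩ := exists_isMatePair h.mem h.le
    have hodd : 2 * T.card = j + 2 := by
      obtain ⟨i, rfl⟩ : ∃ i, j = i + 1 := ⟨j - 1, by omega⟩
      have h1 := hS.prefixCard_card
      have h2 := h.height i (by omega) (by omega)
      omega
    have hb : IsBallot (T.erase j) q := by
      refine ⟨hbase, hmax, fun x hx => ⟨(h.le x (Finset.mem_of_mem_erase hx)).1,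
        Finset.le_max' _ x hx⟩, fun i h1 h2 => ?_⟩
      rw [prefixCard_congr (T' := T)]
      · exact h.height i h1 (by omega)
      · intro x _ hx
        rw [Finset.mem_erase]
        exact ⟨fun h => h.2, fun h => ⟨by omega, h⟩⟩
    obtain ⟨R, j', hR, hRT, hN⟩ := ih q hqj hb
    refine ⟨R, j', hR, hRT.trans (Finset.erase_subset _ _), ?_⟩
    have := hN.step
    rwa [Finset.card_erase_of_mem h.mem, show 2 * (T.card - 1) = j by omega, Finset.union_comm,
      ← Finset.insert_eq, Finset.insert_erase h.mem] at this

/-- One step back at a time: a resistant `R'` above `T' ∪ {2|T'|}` is also above `T'`. Equality with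
the extended set violates the condition on the last element. If the first difference is `2|T'|`,
then either `R' ⊆ T'`, or `R'` continues past `2|T'|` with at most half of `[2|T'|]`, against the
ballot condition. -/
theorem IsNeutralSet.lexLE_of_lexLE {R T R' : Finset ℕ} {j j' : ℕ} (hR : IsResistantSet R j)
    (hT : IsNeutralSet R T) (hR' : IsResistantSet R' j') (h : lexLE T R') : lexLE R R' := by
  induction hT with
  | base => exact h
  | step T' hT' ih =>
    apply ih
    obtain ⟨S, hS⟩ := exists_isMatePair hR.mem hR.le
    -- Only the bound on the maximum and `R ⊆ T'` are wanted, so any `n`, `k` with `2k < n` will do.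
    obtain ⟨S₁, j₁, h₁, hj₁, hRT, -⟩ :=
      hT'.isMatePair_pairCount (n := 1) (k := 0) (by omega) hS hR.lt_two_mul_card
    have h3 := three_le_card_of_subset (hR.base.trans hRT)
    have hlt : ∀ x ∈ T', x < 2 * T'.card := fun x hx => by
      have := (h₁.right_le x hx).2
      omega
    have hnot : 2 * T'.card ∉ T' := fun hc => (hlt _ hc).false
    rw [Finset.union_comm, ← Finset.insert_eq, lexLE_iff] at h
    rcases h with h | ⟨x, hx, hxR', h⟩
    · exfalso
      have hmem : 2 * T'.card ∈ R' := h ▸ Finset.mem_insert_self _ _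
      have hle := (hR'.le _ hmem).2
      have hcard : R'.card = T'.card + 1 := by rw [← h, Finset.card_insert_of_notMem hnot]
      rcases hR'.last with h' | h'
      · rw [h', show ({2, 3, 4} : Finset ℕ).card = 3 by decide] at hcard
        omega
      · omega
    · rw [Finset.mem_insert] at hx
      rcases hx with rfl | hx
      · by_cases hsub : R' ⊆ T'
        · exact lexLE_of_subset hsub
        exfalso
        obtain ⟨z, hz, hzT⟩ := Finset.not_subset.1 hsub
        have hlow : ∀ y < 2 * T'.card, y ∈ R' → y ∈ T' := fun y hy hyR =>
          (Finset.mem_insert.1 ((h y hy).2 hyR)).resolve_left hy.ne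
        have hz1 : ¬ z < 2 * T'.card := fun hc => hzT (hlow z hc hz)
        have hz2 : z ≠ 2 * T'.card := by
          rintro rfl
          exact hxR' hz
        have hz3 := (hR'.le z hz).2
        have hh := hR'.height (2 * T'.card) (by omega) (by omega)
        have : prefixCard R' 1 (2 * T'.card) ≤ T'.card := by
          apply Finset.card_le_card
          intro y hy
          rw [Finset.mem_inter, Finset.mem_Ioc] at hy
          refine hlow y (lt_of_le_of_ne hy.2.2 ?_) hy.1
          rintro rfl
          exact hxR' hy.1
        omega
      · refine lexLE_iff.2 (Or.inr ⟨x, hx, hxR', fun y hy => ?_⟩)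
        rw [← h y hy, Finset.mem_insert]
        have := hlt x hx
        exact ⟨Or.inr, fun h => h.resolve_left (by omega)⟩

/-! ### Resistant pairs are the mates of resistant sets -/

theorem IsMatePair.card_Icc_inter {S T : Finset ℕ} {j i : ℕ} (h : IsMatePair S T j) (hi : i < j) :
    (Finset.Icc 1 i ∩ S).card + prefixCard T 1 i = i := by
  have : T ∩ Finset.Ioc 1 i = Finset.Icc 1 i \ S := by
    ext x
    rw [Finset.mem_inter, Finset.mem_Ioc, Finset.mem_sdiff, Finset.mem_Icc]
    constructor
    · rintro ⟨h1, h2, h3⟩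
      exact ⟨⟨by omega, h3⟩, fun hx => (h.iff x (by omega) (by omega)).1 hx h1⟩
    · rintro ⟨⟨h1, h2⟩, h3⟩
      have hx : x ∈ T := by
        by_contra hx
        exact h3 ((h.iff x h1 (by omega)).2 hx)
      have := h.right_le x hx
      exact ⟨hx, by omega, h2⟩
  unfold prefixCard
  rw [this, Finset.card_inter_add_card_sdiff, Nat.card_Icc]
  omega

/-- Outside the exceptional pair, the inequality at `i = 4` leaves only `1` in `P ∩ [4]`, which puts
`2, 3, 4` into `Q`; the one at `i = j` gives the condition on the last element. -/
theorem IsResistantPair.isResistantSet {n k : ℕ} {P Q : Finset ℕ} (h : IsResistantPair n k P Q) :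
    ∃ j, IsMatePair P Q j ∧ IsResistantSet Q j := by
  obtain ⟨hP, hQ, ⟨rfl, rfl⟩ | ⟨j, -, ⟨hi, hu, -, -⟩, hh⟩⟩ := h
  · have hm : IsMatePair {1, 4} {2, 3, 4} 4 :=
      isMatePair_of_inter_of_union hQ (by decide) (by decide)
    exact ⟨4, hm, ⟨subset_rfl, hm.mem_right, hm.right_le, fun i h1 h2 => by omega⟩, Or.inl rfl⟩
  have hm := isMatePair_of_inter_of_union hQ hi hu
  have hsum : ∀ i, (Finset.Icc 1 i ∩ P).card + (Finset.Icc 1 i \ P).card = i := fun i => by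
    rw [Finset.card_inter_add_card_sdiff, Nat.card_Icc]
    omega
  have hj2 := (hm.right_le j hm.mem_right).1
  have h1P : 1 ∈ P := (hm.iff 1 le_rfl (by omega)).2 fun h1 => by
    have := hm.right_le 1 h1
    omega
  have hnP : ∀ x, 2 ≤ x → x ≤ 4 → x ∉ P := fun x hx hx4 hxP => by
    have h1 := hh 4 le_rfl
    have h2 := hsum 4
    have h3 : (Finset.Icc 1 4 ∩ P).card ≤ 1 := by omega
    have := Finset.card_le_one.1 h3 1 (by simp [h1P]) x
      (Finset.mem_inter.2 ⟨Finset.mem_Icc.2 ⟨by omega, hx4⟩, hxP⟩)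
    omega
  have hj4 : 4 < j := by
    by_contra hc
    exact hnP j hj2 (by omega) hm.mem_left
  refine ⟨j, hm, ⟨fun x hx => ?_, hm.mem_right, hm.right_le, fun i h1 h2 => ?_⟩, Or.inr ?_⟩
  · by_contra hxQ
    simp only [Finset.mem_insert, Finset.mem_singleton] at hx
    exact hnP x (by omega) (by omega) ((hm.iff x (by omega) (by omega)).2 hxQ)
  · have h3 := hh i h1
    have h4 := hsum i
    have h5 := hm.card_Icc_inter h2
    omega
  · have h3 := hh j hj4.le
    have h4 := hsum j
    have h5 := hm.card_add_card
    rw [Finset.inter_eq_right.2 fun x hx => Finset.mem_Icc.2 (hm.left_le x hx)] at h3 h4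
    omega

theorem IsResistantSet.exists_isResistantPair {n k j : ℕ} {T : Finset ℕ} (hn : 2 * k < n)
    (h : IsResistantSet T j) (hk : T.card ≤ k) : ∃ S, IsResistantPair n k S T := by
  obtain ⟨S, hS⟩ := exists_isMatePair h.mem h.le
  have hlt := h.lt_two_mul_card
  refine ⟨S, fun x hx => ?_, fun x hx => ?_, ?_⟩
  · have := hS.left_le x hx
    rw [Finset.mem_Icc]
    omega
  · have := hS.right_le x hx
    rw [Finset.mem_Icc]
    omega
  rcases h.last with rfl | hl
  · have hm : IsMatePair {1, 4} {2, 3, 4} 4 :=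
      isMatePair_of_inter_of_union (n := 4) (by decide) (by decide) (by decide)
    exact Or.inl ⟨rfl, (hS.unique hm).1⟩
  have hcard := hS.card_add_card
  refine Or.inr ⟨j, ⟨h.mem, fun x hx => (h.le x hx).2⟩,
    ⟨hS.inter, hS.union, by omega, hk⟩, fun i hi => ?_⟩
  have hsum : (Finset.Icc 1 i ∩ S).card + (Finset.Icc 1 i \ S).card = i := by
    rw [Finset.card_inter_add_card_sdiff, Nat.card_Icc]
    omega
  rcases lt_or_ge i j with hij | hij
  · have h1 := hS.card_Icc_inter hij
    have h2 := h.height i hi hij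
    omega
  · rw [Finset.inter_eq_right.2 fun x hx => Finset.mem_Icc.2
      ⟨(hS.left_le x hx).1, (hS.left_le x hx).2.trans hij⟩] at hsum ⊢
    omega

/-! ### The first failure of the ballot condition -/

/-- At the first failure `i`, the strict inequality at `i - 1` forces `i ∉ T` and exact balance at
`i`. -/
theorem IsMatePair.isBallot_or {S T : Finset ℕ} {j : ℕ} (h : IsMatePair S T j)
    (hbase : {2, 3, 4} ⊆ T) :
    IsBallot T j ∨ ∃ i q, 4 < i ∧ i < j ∧ i ∉ T ∧ i = 2 * (T ∩ Finset.Ioc 1 i).card ∧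
      IsBallot (T ∩ Finset.Ioc 1 i) q := by
  by_cases hb : ∃ i, 4 ≤ i ∧ i < j ∧ 2 * prefixCard T 1 i ≤ i
  · right
    classical
    have hmin := fun i => Nat.find_min hb (m := i)
    obtain ⟨h4, hj, hp⟩ := Nat.find_spec hb
    set i := Nat.find hb
    have hlow : ∀ i', 4 ≤ i' → i' < i → i' < 2 * prefixCard T 1 i' := fun i' h1 h2 => by
      by_contra hc
      exact hmin i' h2 ⟨h1, by omega, by omega⟩
    have hbU : ∀ i', 4 ≤ i' → {2, 3, 4} ⊆ T ∩ Finset.Ioc 1 i' := fun i' hi' x hx => by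
      rw [Finset.mem_inter, Finset.mem_Ioc]
      refine ⟨hbase hx, ?_⟩
      simp only [Finset.mem_insert, Finset.mem_singleton] at hx
      omega
    have hi4 : 4 < i := by
      refine lt_of_le_of_ne h4 fun hc => ?_
      have := three_le_card_of_subset (hbU i h4)
      change 3 ≤ prefixCard T 1 i at this
      omega
    obtain ⟨i', hi'⟩ : ∃ i', i = i' + 1 := ⟨i - 1, by omega⟩
    have h1 := hlow i' (by omega) (by omega)
    have hiT : i ∉ T := fun hc => by
      rw [hi'] at hc hp
      rw [prefixCard_succ_of_mem (by omega) hc] at hp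
      omega
    have hne : (T ∩ Finset.Ioc 1 i).Nonempty := ⟨2, hbU i h4 (by simp)⟩
    have hmax := Finset.max'_mem _ hne
    refine ⟨i, (T ∩ Finset.Ioc 1 i).max' hne, hi4, hj, hiT, ?_, hbU i h4, hmax,
      fun x hx => ⟨(h.right_le x (Finset.mem_inter.1 hx).1).1, Finset.le_max' _ x hx⟩,
      fun y hy hyq => ?_⟩
    · change i = 2 * prefixCard T 1 i
      rw [hi'] at hiT hp ⊢
      rw [prefixCard_succ_of_notMem (by omega) hiT] at hp ⊢
      omega
    · rw [Finset.mem_inter, Finset.mem_Ioc] at hmax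
      rw [prefixCard_congr (T' := T)]
      · exact hlow y hy (by omega)
      · intro x hx hxy
        rw [Finset.mem_inter, Finset.mem_Ioc]
        exact ⟨fun h => h.1, fun h => ⟨h, hx, by omega⟩⟩
  · left
    refine ⟨hbase, h.mem_right, h.right_le, fun i h1 h2 => ?_⟩
    by_contra hc
    exact hb ⟨i, h1, h2, by omega⟩

theorem prefixCard_add_le_card (T : Finset ℕ) {m i : ℕ} (j : ℕ) :
    prefixCard T m i + prefixCard T i j ≤ T.card := by
  unfold prefixCard
  rw [← Finset.card_union_of_disjoint]
  · exact Finset.card_le_card (Finset.union_subset Finset.inter_subset_left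
      Finset.inter_subset_left)
  · rw [Finset.disjoint_left]
    intro x hx hx'
    rw [Finset.mem_inter, Finset.mem_Ioc] at hx hx'
    omega

/-- After cancelling the prefix below `i`, the claim is that the two tails of `S` and `T` beyond `i`
total less than one full binomial. Balance at `i` gives both tails the same budget `k - i/2`, so the
maximum in `lexCount_add_lexCount_lt` collapses. -/
theorem pairCount_lt {n k i j : ℕ} {S T S' : Finset ℕ} (hn : 2 * k < n) (h : IsMatePair S T j)
    (hi : 4 < i) (hij : i < j) (hiT : i ∉ T) (hu : i = 2 * (T ∩ Finset.Ioc 1 i).card)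
    (h' : IsMatePair S' (insert i (T ∩ Finset.Ioc 1 i)) i) (hS : S.card ≤ k) (hT : T.card ≤ k) :
    pairCount n k S T < pairCount n k S' (insert i (T ∩ Finset.Ioc 1 i)) := by
  change i = 2 * prefixCard T 1 i at hu
  set T' := insert i (T ∩ Finset.Ioc 1 i) with hT'
  have hcard := h.card_add_card
  obtain ⟨p, rfl⟩ : ∃ p, i = p + 1 := ⟨i - 1, by omega⟩
  have hpu : prefixCard T 1 (p + 1) = prefixCard T 1 p := prefixCard_succ_of_notMem (by omega) hiT
  have hST := prefixCard_add_prefixCard (S := S) (T := T) (m := 1) (i := p)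
    fun x h1 h2 => h.iff x (by omega) (by omega)
  have hST0 := prefixCard_add_prefixCard (S := S) (T := T) (m := 0) (i := p + 1)
    fun x h1 h2 => h.iff x (by omega) (by omega)
  have h1T : 0 + 1 ∉ T := fun hc => by
    have := h.right_le _ hc
    omega
  rw [prefixCard_left_of_notMem (by omega) h1T, zero_add] at hST0
  have hleT := prefixCard_add_le_card T (m := 1) (i := p + 1) j
  have hleS := prefixCard_add_le_card S (m := 0) (i := p + 1) j
  have hpos : 0 < prefixCard T (p + 1) j := Finset.card_pos.2
      ⟨j, Finset.mem_inter.2 ⟨h.mem_right, Finset.mem_Ioc.2 ⟨hij, le_rfl⟩⟩⟩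
  have hTT : ∀ x, 1 < x → x ≤ p → (x ∈ T ↔ x ∈ T') := fun x h1 h2 => by
    rw [hT', Finset.mem_insert, Finset.mem_inter, Finset.mem_Ioc]
    exact ⟨fun h => Or.inr ⟨h, h1, by omega⟩, fun h => (h.resolve_left (by omega)).1⟩
  have hSS : ∀ x, 1 < x → x ≤ p → (x ∈ S ↔ x ∈ S') := fun x h1 h2 => by
    rw [h.iff x (by omega) (by omega), h'.iff x (by omega) (by omega), hTT x h1 h2]
  obtain ⟨a, ha⟩ : ∃ a, k = prefixCard T 1 p + (a + 1) := ⟨k - prefixCard T 1 p - 1, by omega⟩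
  have e1 := lexCount_compare (T := T) (T' := T') (n := n) (a := a + 1) (i := p)
    (p - 1) (m := 1) (by omega) (by omega) hTT
  have e2 := lexCount_compare (T := S) (T' := S') (n := n) (a := a + 2) (i := p)
    (p - 1) (m := 1) (by omega) (by omega) hSS
  rw [← ha, lexCount_succ_of_mem (by omega) h'.mem_right, lexCount_succ_of_notMem (by omega) hiT,
    lexCount_of_forall_notMem (S := T') fun x hx => (h'.right_le x hx).2] at e1
  rw [show prefixCard S 1 p + (a + 2) = k - 1 by omega,
    lexCount_succ_of_mem (by omega) h'.mem_left,
    lexCount_succ_of_mem (by omega) ((h.iff (p + 1) (by omega) hij).2 hiT),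
    lexCount_of_forall_notMem (S := S') fun x hx => (h'.left_le x hx).2] at e2
  have e3 := lexCount_add_lexCount_lt h (n := n) (by omega) (j - (p + 1) - 1) (m := p + 1)
    (a := a + 1) (b := a + 1) (by omega) (by omega) (by omega) (by omega)
  rw [max_self] at e3
  unfold pairCount
  omega

/-! ### Locating the resistant set in the enumeration -/

theorem IsResistantSet.base_subset_of_lexLE {n j : ℕ} {T R : Finset ℕ} (hR : IsResistantSet R j)
    (hT : T ⊆ Finset.Icc 2 n) (h : lexLE T R) : {2, 3, 4} ⊆ T := by
  rcases lexLE_iff.1 h with rfl | ⟨x, hx, hxR, h⟩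
  · exact hR.base
  intro y hy
  refine (h y ?_).2 (hR.base hy)
  have h2 := (Finset.mem_Icc.1 (hT hx)).1
  have h3 : x ∉ ({2, 3, 4} : Finset ℕ) := fun hc => hxR (hR.base hc)
  simp only [Finset.mem_insert, Finset.mem_singleton] at hy h3
  omega

theorem IsResistantEnumeration.eq_of_lexLE {n k m l j : ℕ} {Sr Tr : ℕ → Finset ℕ}
    (hr : IsResistantEnumeration n k m Sr Tr) (hn : 2 * k < n) (hl : 1 ≤ l) (hlm : l ≤ m)
    {R T : Finset ℕ} (hR : IsResistantSet R j) (hk : R.card ≤ k) (hlow : lexLT (Tr (l - 1)) T)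
    (hTR : lexLE T R) (hRl : lexLE R (Tr l)) : R = Tr l := by
  obtain ⟨S, hS⟩ := hR.exists_isResistantPair hn hk
  obtain ⟨l', hl', -, rfl⟩ := (hr.mem_iff S R).1 hS
  rw [Finset.mem_Icc] at hl'
  rcases lt_trichotomy l' l with h | rfl | h
  · exfalso
    have h1 : lexLE (Tr l') (Tr (l - 1)) := by
      rcases (Nat.le_sub_one_of_lt h).lt_or_eq with h | h
      · exact (hr.strictMono _ _ h (by omega)).1
      · rw [h]
        exact lexLE_of_subset subset_rfl
    exact hlow.2 (lexLE_antisymm hlow.1 (lexLE_trans hTR h1))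
  · rfl
  · exact lexLE_antisymm hRl (hr.strictMono _ _ h hl'.2).1

theorem mainTheorem7 (n k : ℕ) (hk : 6 ≤ 2 * k) (hn : 2 * k < n)
    (m : ℕ) (Sr Tr : ℕ → Finset ℕ) (hr : IsResistantEnumeration n k m Sr Tr)
    (S T : Finset ℕ) (hS : S ⊆ Finset.Icc 1 n) (hT : T ⊆ Finset.Icc 2 n)
    (hSk : S.card ≤ k) (hTk : T.card ≤ k)
    (hST : StronglyIntersectInLargest S T)
    (A B : Finset (Finset ℕ))
    (hA : A = lexFamily n S (k - 1)) (hB : B = lexFamily n T k)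
    (l : ℕ) (hl : 1 ≤ l) (hlm : l ≤ m)
    (hlow : lexLT (Tr (l - 1)) T) (hup : lexLE T (Tr l)) :
    A.card + B.card = (lexFamily n (Sr l) (k - 1)).card + (lexFamily n (Tr l) k).card ↔
      IsNeutralPair (Tr l) S T := by
  subst hA hB
  change pairCount n k S T = pairCount n k (Sr l) (Tr l) ↔ _
  obtain ⟨j, hi, hu⟩ := id hST
  have hm := isMatePair_of_inter_of_union hT hi hu
  obtain ⟨jl, hml, hRl⟩ := ((hr.mem_iff (Sr l) (Tr l)).2
    ⟨l, Finset.mem_Icc.2 ⟨hl, hlm⟩, rfl, rfl⟩).isResistantSet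
  constructor
  · intro heq
    refine ⟨hST, ?_⟩
    rcases hm.isBallot_or (hRl.base_subset_of_lexLE hT hup) with hb | ⟨i, q, h4, hij, hiT, hiu, hb⟩
    · obtain ⟨R, j', hR, hRT, hN⟩ := hb.exists_isResistantSet
      rwa [hr.eq_of_lexLE hn hl hlm hR ((Finset.card_le_card hRT).trans hTk) hlow
        (lexLE_of_subset hRT) (hN.lexLE_of_lexLE hR hRl hup)] at hN
    · exfalso
      obtain ⟨R, j', hR, hRU, hN⟩ := hb.exists_isResistantSet
      have hRT := hRU.trans Finset.inter_subset_left
      have hN' := hN.step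
      rw [← hiu, Finset.union_comm, ← Finset.insert_eq] at hN'
      have hle : lexLE (insert i (T ∩ Finset.Ioc 1 i)) T := by
        refine lexLE_iff.2 (Or.inr ⟨i, Finset.mem_insert_self _ _, hiT, fun y hy => ?_⟩)
        rw [Finset.mem_insert, Finset.mem_inter, Finset.mem_Ioc]
        refine ⟨fun h => (h.resolve_left hy.ne).1, fun h => Or.inr ⟨h, ?_⟩⟩
        have := (hm.right_le y h).1
        omega
      -- `R ⊆ T` puts `R` above `T`, while `U ∪ {i}`, neutral over `R` and below `T`, forces `R` not
      -- to exceed `Tr l`.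
      obtain rfl := hr.eq_of_lexLE hn hl hlm hR ((Finset.card_le_card hRT).trans hTk) hlow
        (lexLE_of_subset hRT) (hN'.lexLE_of_lexLE hR hRl (lexLE_trans hle hup))
      obtain ⟨S', i', hm', -, -, hc⟩ :=
        hN'.isMatePair_pairCount hn hml hRl.lt_two_mul_card (k := k)
      obtain rfl : i' = i := by
        have h1 := (hm'.right_le i (Finset.mem_insert_self _ _)).2
        have h2 := hm'.mem_right
        rw [Finset.mem_insert, Finset.mem_inter, Finset.mem_Ioc] at h2
        omega
      -- Here `2|U| = i' < j` and `j + 1 = |S| + |T| ≤ 2k`, so there is room for one more element.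
      have hcard : (insert i' (T ∩ Finset.Ioc 1 i')).card ≤ k := by
        have h1 := Finset.card_insert_le i' (T ∩ Finset.Ioc 1 i')
        have h2 := hm.card_add_card
        omega
      have := pairCount_lt hn hm h4 hij hiT hiu hm' hSk hTk
      rw [hc hcard] at this
      omega
  · rintro ⟨-, hN⟩
    obtain ⟨S', j', hm', -, -, hc⟩ := hN.isMatePair_pairCount hn hml hRl.lt_two_mul_card (k := k)
    rw [(hm.unique hm').1]
    exact hc hTk
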